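/- All systems are finite-dimensional, with fixed orthonormal bases; a state is a density matrix and a (quantum) operation is a completely positive trace-preserving (CPTP) linear map. For a state $\rho_{AB}$ with $d_A=\dim\mathcal H_A$ define the singlet fraction $$\mathrm{SF}(\rho_{AB})=\max_{\varepsilon}\,\langle\phi^+|(\mathbb 1_A\otimes\varepsilon)(\rho_{AB})|\phi^+\rangle,\qquad |\phi^+\rangle=\frac1{\sqrt{d_A}}\sum_i|i\rangle|i\rangle,$$ where $\varepsilon$ runs over all operations from $B$ to a copy of $A$. For an ensemble $\{p_i,\rho_i\}$ of states of $B$ let $P_g=\max_{\{P_i\}}\sum_i p_i\operatorname{Tr}(\rho_iP_i)$, the maximum being over POVMs $\{P_i\}$, be its guessing probability. A dynamics on $S$ is a family $(\Lambda_t)_{t\ge0}$ of CPTP maps $B(\mathcal H_S)\to B(\mathcal H_S)$; it is CP-divisible if for all $0\le t\le s$ there is a CPTP map $V_{s,t}$ with $\Lambda_s=V_{s,t}\Lambda_t$. 1. The maximum defining $\mathrm{SF}$ is attained for every state, and $\mathrm{SF}$ does not increase under operations on the second system: $\mathrm{SF}((\mathbb 1_A\otimes N)(\rho_{AB}))\le\mathrm{SF}(\rho_{AB})$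 for every state $\rho_{AB}$ and every operation $N:B\to B'$. 2. For every classical–quantum state $\rho_{CQ}=\sum_{i=1}^{d_A}p_i\,|i\rangle\langle i|\otimes\rho_i$ the maximum defining $P_g$ is attained and $d_A\,\mathrm{SF}(\rho_{CQ})=P_g(\{p_i,\rho_i\})$. 3. Let $(\Lambda_t)_{t\ge0}$ be a dynamics on $S$. If it is CP-divisible, then $t\mapsto\mathrm{SF}((\mathbb 1_A\otimes\Lambda_t)(\rho_{AS}))$ is non-increasing for every ancilla $A$ and every initial state $\rho_{AS}$. If it is not CP-divisible, then $\mathrm{SF}$ shows a backflow: there are an ancilla $A$ (of the same dimension as $S$), an initial state $\rho_{AS}$ and times $0\le t\le s$ with $$\mathrm{SF}((\mathbb 1_A\otimes\Lambda_s)(\rho_{AS}))>\mathrm{SF}((\mathbb 1_A\otimes\Lambda_t)(\rho_{AS})).$$ More precisely, whenever $0\le t\le s$ and there is no CPTP map $V$ with $\Lambda_s=V\Lambda_t$, such a state exists for this pair of times. -/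

import Mathlib

open scoped ComplexOrder NNReal

noncomputable section

namespace QInfo

/-- Density matrices on the Hilbert space with orthonormal basis indexed by `n`. -/
def IsState {n : Type*} [Fintype n] (ρ : Matrix n n ℂ) : Prop :=
  ρ.PosSemidef ∧ ρ.trace = 1

/-- `𝟙 ⊗ Φ`: the map `Φ` applied to the second factor of a bipartite operator; the operator
is cut into blocks indexed by the first factor, and `Φ` acts on each block. -/
def idTensor {k m n : Type*} (Φ : Matrix m m ℂ →ₗ[ℂ] Matrix n n ℂ)
    (X : Matrix (k × m) (k × m) ℂ) : Matrix (k × n) (k × n) ℂ :=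
  Matrix.of fun a b => Φ (Matrix.of fun i j => X (a.1, i) (b.1, j)) a.2 b.2

/-- Complete positivity: `𝟙_k ⊗ Φ` preserves positive semidefiniteness for every dimension `k`
of the ancilla. -/
def IsCP {m n : Type*} (Φ : Matrix m m ℂ →ₗ[ℂ] Matrix n n ℂ) : Prop :=
  ∀ (k : ℕ) (X : Matrix (Fin k × m) (Fin k × m) ℂ),
    X.PosSemidef → (idTensor Φ X).PosSemidef

/-- Quantum operations (CPTP maps). -/
def IsChannel {m n : Type*} [Fintype m] [Fintype n]
    (Φ : Matrix m m ℂ →ₗ[ℂ] Matrix n n ℂ) : Prop :=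
  IsCP Φ ∧ ∀ X, (Φ X).trace = X.trace

/-- The maximally entangled unit vector `|φ⁺⟩ = d^{-1/2} ∑ᵢ |i⟩|i⟩`. -/
def phiPlus (A : Type*) [Fintype A] [DecidableEq A] : A × A → ℂ :=
  fun x => if x.1 = x.2 then (((Real.sqrt (Fintype.card A))⁻¹ : ℝ) : ℂ) else 0

/-- `⟨φ⁺|σ|φ⁺⟩`, which is a real number when `σ` is Hermitian. -/
def overlap {A : Type*} [Fintype A] [DecidableEq A] (σ : Matrix (A × A) (A × A) ℂ) : ℝ :=
  (star (phiPlus A) ⬝ᵥ (σ.mulVec (phiPlus A))).re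

/-- The values `⟨φ⁺|(𝟙 ⊗ ε)(ρ)|φ⁺⟩`, for `ε` ranging over the quantum operations that send
the second system to a copy of the first one. -/
def sfValues {A B : Type*} [Fintype A] [DecidableEq A] [Fintype B]
    (ρ : Matrix (A × B) (A × B) ℂ) : Set ℝ :=
  {x | ∃ ε : Matrix B B ℂ →ₗ[ℂ] Matrix A A ℂ, IsChannel ε ∧ x = overlap (idTensor ε ρ)}

/-- The singlet fraction. -/
def singletFraction {A B : Type*} [Fintype A] [DecidableEq A] [Fintype B]
    (ρ : Matrix (A × B) (A × B) ℂ) : ℝ :=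
  sSup (sfValues ρ)

/-- `{p i, ρ i}` is an ensemble of states. -/
def IsEnsemble {I B : Type*} [Fintype I] [Fintype B] (p : I → ℝ) (ρ : I → Matrix B B ℂ) : Prop :=
  (∀ i, 0 ≤ p i) ∧ ∑ i, p i = 1 ∧ ∀ i, IsState (ρ i)

/-- POVMs with outcomes in `I`. -/
def IsPOVM {I B : Type*} [Fintype I] [DecidableEq B] (P : I → Matrix B B ℂ) : Prop :=
  (∀ i, (P i).PosSemidef) ∧ ∑ i, P i = 1

/-- The success probabilities `∑ᵢ pᵢ Tr(ρᵢ Pᵢ)` over all POVMs. -/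
def guessValues {I B : Type*} [Fintype I] [Fintype B] [DecidableEq B]
    (p : I → ℝ) (ρ : I → Matrix B B ℂ) : Set ℝ :=
  {x | ∃ P : I → Matrix B B ℂ, IsPOVM P ∧ x = ∑ i, p i * ((ρ i * P i).trace).re}

/-- The guessing probability of an ensemble. -/
def guessingProbability {I B : Type*} [Fintype I] [Fintype B] [DecidableEq B]
    (p : I → ℝ) (ρ : I → Matrix B B ℂ) : ℝ :=
  sSup (guessValues p ρ)

/-- The classical–quantum state `∑ᵢ pᵢ |i⟩⟨i| ⊗ ρᵢ`. -/
def cqState {I B : Type*} [Fintype I] [DecidableEq I] (p : I → ℝ) (ρ : I → Matrix B B ℂ) :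
    Matrix (I × B) (I × B) ℂ :=
  ∑ i, (p i : ℂ) • Matrix.kroneckerMap (· * ·) (Matrix.single i i (1 : ℂ)) (ρ i)

/-- There is a CPTP intermediate map `V` with `Λ_s = V ∘ Λ_t`. -/
def HasCPIntermediate {S : Type*} [Fintype S]
    (Λ : ℝ≥0 → Matrix S S ℂ →ₗ[ℂ] Matrix S S ℂ) (s t : ℝ≥0) : Prop :=
  ∃ V : Matrix S S ℂ →ₗ[ℂ] Matrix S S ℂ, IsChannel V ∧ Λ s = V ∘ₗ Λ t

/-- CP-divisibility (Markovianity) of a dynamics `(Λ_t)_{t ≥ 0}`. -/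
def IsCPDivisible {S : Type*} [Fintype S]
    (Λ : ℝ≥0 → Matrix S S ℂ →ₗ[ℂ] Matrix S S ℂ) : Prop :=
  ∀ t s : ℝ≥0, t ≤ s → HasCPIntermediate Λ s t

end QInfo

end

/-! Through the Choi correspondence (`ofChoi_choi`, `choi_mem_choiSet`, `isChannel_ofChoi`),
channels become the compact convex set `choiSet`, and the overlap with the maximally entangled state
becomes a pairing linear in the Choi matrix. Compactness gives attainment; monotonicity holds
because a decoder after `N` is, composed with `N`, a decoder for the original state. On
classical-quantum states only the diagonal blocks of the Choi matrix are paired, and these are, up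
to transposition, exactly the POVMs. Backflow is a separation argument. The Choi matrices of all `V
∘ Φ`, `V` a channel, form a compact convex set; if `Ψ` is not of this form, Hahn-Banach separates it
strictly. On channels the separating functional is an increasing affine function of the overlap for
some state (`exists_isState_sfPairing_eq`), so for that state `Ψ` with the trivial decoder beats
every decoder after `Φ`. -/

noncomputable section

namespace QInfo

open Matrix

/-! ### The Choi matrix -/

section Choi

variable {m n : Type*} [Fintype m]

/-- The Choi matrix of a linear map between matrix spaces. -/
def choi [DecidableEq m] (Φ : Matrix m m ℂ →ₗ[ℂ] Matrix n n ℂ) : Matrix (m × n) (m × n) ℂ :=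
  Matrix.of fun x y => Φ (Matrix.single x.1 y.1 1) x.2 y.2

/-- The linear map with a given Choi matrix. -/
def ofChoi (C : Matrix (m × n) (m × n) ℂ) : Matrix m m ℂ →ₗ[ℂ] Matrix n n ℂ where
  toFun X := Matrix.of fun a b => ∑ i, ∑ j, X i j * C (i, a) (j, b)
  map_add' X Y := by
    ext a b
    simp [add_mul, Finset.sum_add_distrib]
  map_smul' c X := by
    ext a b
    simp [Finset.mul_sum, mul_assoc]

lemma ofChoi_apply (C : Matrix (m × n) (m × n) ℂ) (X : Matrix m m ℂ) (a b : n) :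
    ofChoi C X a b = ∑ i, ∑ j, X i j * C (i, a) (j, b) := rfl

lemma ofChoi_choi [DecidableEq m] (Φ : Matrix m m ℂ →ₗ[ℂ] Matrix n n ℂ) :
    ofChoi (choi Φ) = Φ := by
  refine LinearMap.ext fun X => ?_
  ext a b
  conv_rhs => rw [Matrix.matrix_eq_sum_single X]
  rw [ofChoi_apply, map_sum, Matrix.sum_apply]
  refine Finset.sum_congr rfl fun i _ => ?_
  rw [map_sum, Matrix.sum_apply]
  refine Finset.sum_congr rfl fun j _ => ?_
  have : Matrix.single i j (X i j) = X i j • Matrix.single i j (1 : ℂ) := by simp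
  rw [this, map_smul, Matrix.smul_apply, smul_eq_mul]
  rfl

lemma posSemidef_choi [DecidableEq m] {Φ : Matrix m m ℂ →ₗ[ℂ] Matrix n n ℂ} (h : IsCP Φ) :
    (choi Φ).PosSemidef := by
  let e := (Fintype.equivFin m).symm
  -- The unnormalised maximally entangled vector, with the ancilla reindexed by `Fin`, as `IsCP`
  -- requires.
  let v : Fin (Fintype.card m) × m → ℂ := fun x => if e x.1 = x.2 then 1 else 0
  have hv := (h _ _ (posSemidef_vecMulVec_self_star v)).submatrix
    fun x : m × n => (e.symm x.1, x.2)
  convert hv using 1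
  ext x y
  have hblock : Matrix.of (fun i j => vecMulVec v (star v) (e.symm x.1, i) (e.symm y.1, j)) =
      Matrix.single x.1 y.1 1 := by
    ext i j
    by_cases h₁ : x.1 = i <;> by_cases h₂ : y.1 = j <;>
      simp [vecMulVec_apply, v, Matrix.single, h₁, h₂]
  simp only [choi, submatrix_apply, idTensor, of_apply]
  rw [hblock]

lemma isCP_ofChoi [Finite n] {C : Matrix (m × n) (m × n) ℂ} (hC : C.PosSemidef) :
    IsCP (ofChoi C) := by
  classical
  have := Fintype.ofFinite n
  intro k X hX
  -- `W` identifies the two copies of `m`, so compressing `X ⊗ C` by it contracts the input index of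
  -- `C` with `X`.
  let W : Matrix ((Fin k × m) × (m × n)) (Fin k × n) ℂ :=
    Matrix.of fun x y => if x.1.1 = y.1 ∧ x.1.2 = x.2.1 ∧ x.2.2 = y.2 then 1 else 0
  have h : idTensor (ofChoi C) X = Wᴴ * kroneckerMap (· * ·) X C * W := by
    ext ⟨r, a⟩ ⟨s, b⟩
    simp only [idTensor, of_apply, ofChoi_apply, W, mul_apply, conjTranspose_apply,
      kroneckerMap_apply, Fintype.sum_prod_type, ite_and, apply_ite star, star_one, star_zero,
      ite_mul, mul_ite, one_mul, mul_one, zero_mul, mul_zero, Finset.sum_ite_eq,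
      Finset.sum_ite_eq', Finset.mem_univ, if_true, Finset.sum_ite_irrel, Finset.sum_const_zero]
    rw [Finset.sum_comm]
  rw [h]
  exact (hX.kronecker hC).conjTranspose_mul_mul_same W

/-- The Choi matrices of the quantum operations. -/
def choiSet (m n : Type*) [Fintype m] [DecidableEq m] [Fintype n] :
    Set (Matrix (m × n) (m × n) ℂ) :=
  {C | C.PosSemidef ∧ ∀ i j, ∑ a, C (i, a) (j, a) = if i = j then 1 else 0}

variable [Fintype n] [DecidableEq m]

lemma choi_mem_choiSet {Φ : Matrix m m ℂ →ₗ[ℂ] Matrix n n ℂ} (h : IsChannel Φ) :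
    choi Φ ∈ choiSet m n := by
  refine ⟨posSemidef_choi h.1, fun i j => ?_⟩
  have := h.2 (Matrix.single i j 1)
  by_cases hij : i = j
  · subst hij
    simpa [Matrix.trace, choi] using this
  · rw [Matrix.trace_single_eq_of_ne i j 1 hij] at this
    simpa [Matrix.trace, choi, hij] using this

lemma isChannel_ofChoi {C : Matrix (m × n) (m × n) ℂ} (h : C ∈ choiSet m n) :
    IsChannel (ofChoi C) := by
  refine ⟨isCP_ofChoi h.1, fun X => ?_⟩
  simp only [Matrix.trace, diag_apply, ofChoi_apply]
  rw [Finset.sum_comm]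
  refine Finset.sum_congr rfl fun i _ => ?_
  rw [Finset.sum_comm]
  simp [← Finset.mul_sum, h.2]

lemma choiSet_nonempty [Nonempty n] : (choiSet m n).Nonempty := by
  classical
  obtain ⟨a₀⟩ := ‹Nonempty n›
  -- The channel that replaces every input `X` by `tr X` times the projector onto `a₀`.
  refine ⟨diagonal fun x => if x.2 = a₀ then 1 else 0, .diagonal fun x => ?_, fun i j => ?_⟩
  · dsimp only
    split_ifs <;> simp
  · by_cases hij : i = j <;> simp [hij]

end Choi

/-! ### Compactness and convexity of the set of operations -/

section Compact

variable {m n : Type*}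

/-- Nonnegativity of the 2 × 2 principal minors bounds `|M i j|²` by `M i i * M j j`. -/
lemma _root_.Matrix.PosSemidef.norm_apply_le_of_diag_le {M : Matrix n n ℂ} (hM : M.PosSemidef)
    {r : ℝ} (hr : ∀ i, (M i i).re ≤ r) (i j : n) : ‖M i j‖ ≤ r := by
  have hdet := (hM.submatrix ![i, j]).det_nonneg
  have hi := hM.diag_nonneg (i := i)
  have hj := hM.diag_nonneg (i := j)
  rw [Complex.le_def] at hi hj hdet
  have hji : M j i = star (M i j) := (hM.1.apply j i).symm
  have hmul : M i j * star (M i j) = ((‖M i j‖ ^ 2 : ℝ) : ℂ) := by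
    rw [Complex.star_def, Complex.mul_conj, Complex.normSq_eq_norm_sq]
  simp only [det_fin_two, submatrix_apply, Matrix.cons_val_zero, Matrix.cons_val_one, hji, hmul,
    Complex.sub_re, Complex.mul_re, Complex.ofReal_re, Complex.zero_re, Complex.zero_im] at hdet hi hj
  rw [← hi.2, ← hj.2] at hdet
  have h₁ := hr i
  have h₂ := hr j
  have hr₀ : 0 ≤ r := hi.1.trans h₁
  refine abs_le_of_sq_le_sq' ?_ hr₀ |>.2
  nlinarith [mul_le_mul h₁ h₂ hj.1 hr₀, hdet.1]

lemma _root_.Matrix.isClosed_posSemidef [Fintype n] :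
    IsClosed {M : Matrix n n ℂ | M.PosSemidef} := by
  simp only [posSemidef_iff_dotProduct_mulVec, Set.ofPred_and, Set.ofPred_forall, IsHermitian]
  refine IsClosed.inter (isClosed_eq (by fun_prop) (by fun_prop)) (isClosed_iInter fun x => ?_)
  exact isClosed_le continuous_const (by fun_prop)

lemma isClosed_choiSet [Fintype m] [DecidableEq m] [Fintype n] : IsClosed (choiSet m n) := by
  simp only [choiSet, Set.ofPred_and, Set.ofPred_forall]
  refine IsClosed.inter isClosed_posSemidef ?_
  exact isClosed_iInter fun i => isClosed_iInter fun j => isClosed_eq (by fun_prop) (by fun_prop)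

lemma isCompact_choiSet [Fintype m] [DecidableEq m] [Fintype n] : IsCompact (choiSet m n) := by
  have hK : IsCompact (Set.univ.pi fun _ : m × n => Set.univ.pi fun _ : m × n =>
      Metric.closedBall (0 : ℂ) 1) :=
    isCompact_univ_pi fun _ => isCompact_univ_pi fun _ => isCompact_closedBall 0 1
  refine hK.of_isClosed_subset isClosed_choiSet fun C hC x _ y _ => ?_
  rw [mem_closedBall_zero_iff]
  refine hC.1.norm_apply_le_of_diag_le (fun z => ?_) x y
  have h := congrArg Complex.re (hC.2 z.1 z.1)
  rw [if_pos rfl, Complex.re_sum, Complex.one_re] at h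
  rw [← h]
  exact Finset.single_le_sum (f := fun a => (C (z.1, a) (z.1, a)).re)
    (fun a _ => (Complex.le_def.1 hC.1.diag_nonneg).1) (Finset.mem_univ z.2)

lemma convex_choiSet [Fintype m] [DecidableEq m] [Fintype n] : Convex ℝ (choiSet m n) := by
  intro C hC D hD s t hs ht hst
  refine ⟨(hC.1.smul hs).add (hD.1.smul ht), fun i j => ?_⟩
  simp only [Matrix.add_apply, Matrix.smul_apply, Finset.sum_add_distrib, ← Finset.smul_sum,
    hC.2, hD.2, ← add_smul, hst, one_smul]

end Compact

/-! ### Singlet fraction in terms of Choi matrices -/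

section SingletFraction

variable {A B B' : Type*} [Fintype A] [DecidableEq A] [Fintype B] [Fintype B']

lemma overlap_eq (σ : Matrix (A × A) (A × A) ℂ) :
    overlap σ = (Fintype.card A : ℝ)⁻¹ * (∑ a, ∑ b, σ (a, a) (b, b)).re := by
  have h : ((((Real.sqrt (Fintype.card A))⁻¹ : ℝ) : ℂ)) * (((Real.sqrt (Fintype.card A))⁻¹ : ℝ) : ℂ)
      = (((Fintype.card A : ℝ)⁻¹ : ℝ) : ℂ) := by
    rw [← Complex.ofReal_mul, ← mul_inv, Real.mul_self_sqrt (Nat.cast_nonneg _)]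
  rw [← Complex.re_ofReal_mul, ← h, overlap]
  simp only [dotProduct, mulVec, phiPlus, Pi.star_apply, Fintype.sum_prod_type, apply_ite star,
    star_zero, Complex.star_def, Complex.conj_ofReal, ite_mul, mul_ite, zero_mul, mul_zero,
    Finset.sum_ite_irrel, Finset.sum_const_zero, Finset.sum_ite_eq, Finset.mem_univ, if_true,
    Finset.mul_sum]
  congr 1
  refine Finset.sum_congr rfl fun a _ => Finset.sum_congr rfl fun b _ => ?_
  ring

/-- The overlap with the maximally entangled state after an operation on the second system, as a
function of the Choi matrix of the operation. -/
def sfPairing (ρ : Matrix (A × B) (A × B) ℂ) (C : Matrix (B × A) (B × A) ℂ) : ℝ :=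
  (Fintype.card A : ℝ)⁻¹ * (∑ a, ∑ b, ∑ i, ∑ j, ρ (a, i) (b, j) * C (i, a) (j, b)).re

lemma overlap_idTensor_ofChoi (ρ : Matrix (A × B) (A × B) ℂ) (C : Matrix (B × A) (B × A) ℂ) :
    overlap (idTensor (ofChoi C) ρ) = sfPairing ρ C :=
  overlap_eq _

lemma overlap_idTensor [DecidableEq B] (ρ : Matrix (A × B) (A × B) ℂ)
    (Φ : Matrix B B ℂ →ₗ[ℂ] Matrix A A ℂ) :
    overlap (idTensor Φ ρ) = sfPairing ρ (choi Φ) := by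
  rw [← overlap_idTensor_ofChoi, ofChoi_choi]

lemma sfValues_eq_image [DecidableEq B] (ρ : Matrix (A × B) (A × B) ℂ) :
    sfValues ρ = sfPairing ρ '' choiSet B A := by
  ext x
  constructor
  · rintro ⟨ε, hε, rfl⟩
    exact ⟨choi ε, choi_mem_choiSet hε, (overlap_idTensor ρ ε).symm⟩
  · rintro ⟨C, hC, rfl⟩
    exact ⟨ofChoi C, isChannel_ofChoi hC, (overlap_idTensor_ofChoi ρ C).symm⟩

/-- The maximum in the definition of the singlet fraction is attained. -/
theorem isGreatest_singletFraction [Nonempty A] (ρ : Matrix (A × B) (A × B) ℂ) :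
    IsGreatest (sfValues ρ) (singletFraction ρ) := by
  classical
  have hcont : Continuous (sfPairing ρ) := by
    unfold sfPairing
    fun_prop
  rw [singletFraction, sfValues_eq_image]
  exact (isCompact_choiSet.image hcont).isGreatest_sSup (choiSet_nonempty.image _)

lemma idTensor_comp {k l m n : Type*} (Ψ : Matrix m m ℂ →ₗ[ℂ] Matrix n n ℂ)
    (Φ : Matrix l l ℂ →ₗ[ℂ] Matrix m m ℂ) (X : Matrix (k × l) (k × l) ℂ) :
    idTensor (Ψ ∘ₗ Φ) X = idTensor Ψ (idTensor Φ X) := rfl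

lemma IsChannel.comp {l m n : Type*} [Fintype l] [Fintype m] [Fintype n]
    {Ψ : Matrix m m ℂ →ₗ[ℂ] Matrix n n ℂ} {Φ : Matrix l l ℂ →ₗ[ℂ] Matrix m m ℂ}
    (hΨ : IsChannel Ψ) (hΦ : IsChannel Φ) : IsChannel (Ψ ∘ₗ Φ) :=
  ⟨fun k X hX => hΨ.1 k _ (hΦ.1 k X hX), fun X => (hΨ.2 _).trans (hΦ.2 X)⟩

lemma isChannel_id {m : Type*} [Fintype m] :
    IsChannel (LinearMap.id : Matrix m m ℂ →ₗ[ℂ] Matrix m m ℂ) :=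
  ⟨fun _ _ hX => hX, fun _ => rfl⟩

lemma nonempty_of_isState {m n : Type*} [Fintype m] [Fintype n]
    {ρ : Matrix (m × n) (m × n) ℂ} (h : IsState ρ) : Nonempty m := by
  by_contra hm
  rw [not_nonempty_iff] at hm
  simpa [Matrix.trace] using h.2

/-- The singlet fraction does not increase under operations on the second system. -/
theorem singletFraction_idTensor_le [Nonempty A] (ρ : Matrix (A × B) (A × B) ℂ)
    {N : Matrix B B ℂ →ₗ[ℂ] Matrix B' B' ℂ} (hN : IsChannel N) :
    singletFraction (idTensor N ρ) ≤ singletFraction ρ := by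
  obtain ⟨ε, hε, h⟩ := (isGreatest_singletFraction (idTensor N ρ)).1
  rw [h, ← idTensor_comp]
  exact (isGreatest_singletFraction ρ).2 ⟨_, hε.comp hN, rfl⟩

/-! ### Guessing probability -/

omit [Fintype B] in
lemma cqState_apply (p : A → ℝ) (ρ : A → Matrix B B ℂ) (a b : A) (i j : B) :
    cqState p ρ (a, i) (b, j) = if a = b then (p a : ℂ) * ρ a i j else 0 := by
  simp only [cqState, Matrix.sum_apply, Matrix.smul_apply, kroneckerMap_apply, smul_eq_mul]
  rw [Finset.sum_eq_single a]
  · by_cases h : a = b <;> simp [Matrix.single, h]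
  · intro c _ hc
    simp [Matrix.single, hc]
  · simp

lemma card_mul_sfPairing_cqState [Nonempty A] (p : A → ℝ) (ρ : A → Matrix B B ℂ)
    (C : Matrix (B × A) (B × A) ℂ) :
    (Fintype.card A : ℝ) * sfPairing (cqState p ρ) C =
      ∑ a, p a * ((ρ a * (C.submatrix (·, a) (·, a))ᵀ).trace).re := by
  have hc : (Fintype.card A : ℝ) ≠ 0 := by simp
  rw [sfPairing, mul_inv_cancel_left₀ hc, Complex.re_sum]
  refine Finset.sum_congr rfl fun a _ => ?_
  rw [← Complex.re_ofReal_mul]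
  simp [cqState_apply, Matrix.trace, mul_apply, ite_mul, Finset.sum_ite_irrel, Finset.mul_sum,
    mul_assoc]

lemma guessValues_eq_image [Nonempty A] [DecidableEq B] (p : A → ℝ) (ρ : A → Matrix B B ℂ) :
    guessValues p ρ = (fun x => (Fintype.card A : ℝ) * x) '' sfValues (cqState p ρ) := by
  rw [sfValues_eq_image, Set.image_image]
  ext x
  constructor
  · rintro ⟨P, ⟨hP, hsum⟩, rfl⟩
    -- The measure-and-prepare channel: measure `P`, then prepare the basis state of the outcome.
    let C : Matrix (B × A) (B × A) ℂ :=
      ∑ a, kroneckerMap (· * ·) (P a)ᵀ (Matrix.single a a 1)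
    have hCapp (i j : B) (a b : A) : C (i, a) (j, b) = if a = b then P a j i else 0 := by
      simp only [C, Matrix.sum_apply, kroneckerMap_apply, transpose_apply]
      rw [Finset.sum_eq_single a]
      · by_cases h : a = b <;> simp [Matrix.single, h]
      · intro c _ hc
        simp [Matrix.single, hc]
      · simp
    refine ⟨C, ⟨posSemidef_sum _ fun a _ => (hP a).transpose.kronecker ?_, fun i j => ?_⟩, ?_⟩
    · rw [← diagonal_single]
      exact .diagonal (Pi.single_nonneg.2 zero_le_one)
    · simp only [hCapp, if_true]
      rw [← Matrix.sum_apply, hsum, one_apply]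
      simp [eq_comm]
    · dsimp only
      rw [card_mul_sfPairing_cqState]
      refine Finset.sum_congr rfl fun a _ => ?_
      congr 4
      ext i j
      simp [hCapp]
  · rintro ⟨C, hC, rfl⟩
    refine ⟨fun a => (C.submatrix (·, a) (·, a))ᵀ,
      ⟨fun a => (hC.1.submatrix _).transpose, ?_⟩, card_mul_sfPairing_cqState p ρ C⟩
    ext i j
    simp [Matrix.sum_apply, hC.2, one_apply, eq_comm]

/-- The guessing probability is attained, and equals `d_A` times the singlet fraction of the
classical-quantum state. -/
theorem isGreatest_guessingProbability [Nonempty A] [DecidableEq B] (p : A → ℝ)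
    (ρ : A → Matrix B B ℂ) :
    IsGreatest (guessValues p ρ) (guessingProbability p ρ) ∧
      (Fintype.card A : ℝ) * singletFraction (cqState p ρ) = guessingProbability p ρ := by
  have hmono : Monotone fun x : ℝ => (Fintype.card A : ℝ) * x :=
    fun x y hxy => mul_le_mul_of_nonneg_left hxy (Nat.cast_nonneg _)
  have h := hmono.map_isGreatest (isGreatest_singletFraction (cqState p ρ))
  rw [← guessValues_eq_image] at h
  have heq : guessingProbability p ρ = Fintype.card A * singletFraction (cqState p ρ) :=
    h.csSup_eq
  exact ⟨heq ▸ h, heq.symm⟩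

end SingletFraction

/-! ### Detection of every dynamics that is not CP-divisible -/

section Detection

lemma _root_.Matrix.IsHermitian.exists_posDef_add_smul_one {n : Type*} [Fintype n]
    [DecidableEq n] {H : Matrix n n ℂ} (hH : H.IsHermitian) :
    ∃ c : ℝ, (H + (c : ℂ) • (1 : Matrix n n ℂ)).PosDef := by
  open scoped Matrix.Norms.L2Operator MatrixOrder in
  have h := IsSelfAdjoint.neg_algebraMap_norm_le_self (a := H) hH
  rw [Matrix.le_iff, sub_neg_eq_add] at h
  refine ⟨‖H‖ + 1, ?_⟩
  have heq : H + ((‖H‖ + 1 : ℝ) : ℂ) • (1 : Matrix n n ℂ) =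
      H + algebraMap ℝ (Matrix n n ℂ) ‖H‖ + 1 := by
    rw [add_assoc, Complex.ofReal_add, add_smul, Complex.ofReal_one, one_smul,
      Algebra.algebraMap_eq_smul_one, Complex.coe_smul]
  rw [heq]
  exact PosDef.posSemidef_add h PosDef.one

variable {S : Type*} [Fintype S] [DecidableEq S]

/-- Trace preservation makes this constant, so adding a multiple of the identity to an operator
shifts all its pairings with channels equally. -/
lemma sfPairing_one [Nonempty S] {C : Matrix (S × S) (S × S) ℂ} (hC : C ∈ choiSet S S) :
    sfPairing (1 : Matrix (S × S) (S × S) ℂ) C = 1 := by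
  have h : ∑ a, ∑ b, ∑ i, ∑ j, (1 : Matrix (S × S) (S × S) ℂ) (a, i) (b, j) * C (i, a) (j, b) =
      ∑ i, ∑ a, C (i, a) (i, a) := by
    rw [Finset.sum_comm (γ := S) (f := fun i a => C (i, a) (i, a))]
    refine Finset.sum_congr rfl fun a _ => ?_
    rw [Finset.sum_comm]
    refine Finset.sum_congr rfl fun i _ => ?_
    simp [one_apply, Prod.mk.injEq, ite_and]
  rw [sfPairing, h]
  simp [hC.2]

/-- The real part of a linear functional on Choi matrices of channels is, up to shift and positive
scale, the overlap with the
maximally entangled state for a suitable initial state. -/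
lemma exists_isState_sfPairing_eq [Nonempty S] (f : Matrix (S × S) (S × S) ℂ →ₗ[ℂ] ℂ) :
    ∃ (ρ : Matrix (S × S) (S × S) ℂ) (r c : ℝ), IsState ρ ∧ 0 < r ∧
      ∀ C ∈ choiSet S S, sfPairing ρ C = r * (f C).re + c := by
  let G : Matrix (S × S) (S × S) ℂ := Matrix.of fun x y => f (Matrix.single x y 1)
  have hf (M : Matrix (S × S) (S × S) ℂ) : f M = ∑ x, ∑ y, M x y * G x y := by
    conv_lhs => rw [Matrix.matrix_eq_sum_single M]
    simp only [map_sum]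
    refine Finset.sum_congr rfl fun x _ => Finset.sum_congr rfl fun y _ => ?_
    have : Matrix.single x y (M x y) = M x y • Matrix.single x y (1 : ℂ) := by simp
    rw [this, map_smul, smul_eq_mul]
    rfl
  -- Symmetrising keeps twice the real part of `f` on Hermitian matrices; the swap matches the
  -- opposite index orders of state and Choi matrix in `sfPairing`.
  let H : Matrix (S × S) (S × S) ℂ := (G + Gᴴ).submatrix Prod.swap Prod.swap
  have hH : H.IsHermitian := (isHermitian_add_transpose_self G).submatrix _
  obtain ⟨c, hc⟩ := hH.exists_posDef_add_smul_one
  have hf₂ (C : Matrix (S × S) (S × S) ℂ) (hC : C.IsHermitian) :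
      (∑ a, ∑ b, ∑ i, ∑ j, H (a, i) (b, j) * C (i, a) (j, b)).re = 2 * (f C).re := by
    have h₁ : ∑ a, ∑ b, ∑ i, ∑ j, H (a, i) (b, j) * C (i, a) (j, b) =
        ∑ x, ∑ y, (C x y * G x y + star (C y x * G y x)) := by
      have : ∀ x y, (G x y + Gᴴ x y) * C x y = C x y * G x y + star (C y x * G y x) := by
        intro x y
        rw [conjTranspose_apply, star_mul', hC.apply]
        ring
      simp only [← this, Fintype.sum_prod_type]
      refine Eq.trans (Finset.sum_congr rfl fun a _ => ?_) Finset.sum_comm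
      rw [Finset.sum_comm]
      refine Finset.sum_congr rfl fun i _ => ?_
      rw [Finset.sum_comm]
      rfl
    rw [h₁]
    simp only [Finset.sum_add_distrib]
    rw [Finset.sum_comm (f := fun x y => star (C y x * G y x)), hf]
    simp only [Complex.add_re, Complex.star_def, ← map_sum, Complex.conj_re]
    ring
  let t : ℝ := (H + (c : ℂ) • (1 : Matrix (S × S) (S × S) ℂ)).trace.re
  have ht : 0 < t := (Complex.lt_def.1 hc.trace_pos).1
  have htc : (H + (c : ℂ) • (1 : Matrix (S × S) (S × S) ℂ)).trace = (t : ℂ) :=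
    Complex.ext rfl (Complex.lt_def.1 hc.trace_pos).2.symm
  -- The shift by `c` gives positivity and `t` normalises the trace; the factor 2 comes from
  -- symmetrising, and `1 / card S` from the overlap.
  refine ⟨((t⁻¹ : ℝ) : ℂ) • (H + (c : ℂ) • 1), t⁻¹ * ((Fintype.card S : ℝ)⁻¹ * 2), t⁻¹ * c,
    ⟨hc.posSemidef.smul (Complex.zero_le_real.2 (inv_nonneg.2 ht.le)), ?_⟩, ?_, fun C hC => ?_⟩
  · rw [trace_smul, htc, smul_eq_mul, ← Complex.ofReal_mul, inv_mul_cancel₀ ht.ne',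
      Complex.ofReal_one]
  · have : (0 : ℝ) < Fintype.card S := by exact_mod_cast Fintype.card_pos
    positivity
  · have h₁ := sfPairing_one hC
    have h₂ := hf₂ C hC.1.1
    rw [sfPairing] at h₁ ⊢
    simp only [Matrix.smul_apply, Matrix.add_apply, smul_eq_mul, mul_assoc, add_mul,
      Finset.sum_add_distrib, ← Finset.mul_sum, Complex.re_ofReal_mul, Complex.add_re, h₂]
    linear_combination (t⁻¹ * c) * h₁

/-- If there is no channel `V` with `Ψ = V ∘ Φ`, then some state has a larger singlet fraction after
`Ψ` than after `Φ`. -/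
theorem exists_singletFraction_lt {Φ Ψ : Matrix S S ℂ →ₗ[ℂ] Matrix S S ℂ} (hΦ : IsChannel Φ)
    (hΨ : IsChannel Ψ) (h : ¬ ∃ V : Matrix S S ℂ →ₗ[ℂ] Matrix S S ℂ, IsChannel V ∧ Ψ = V ∘ₗ Φ) :
    ∃ ρ : Matrix (S × S) (S × S) ℂ, IsState ρ ∧
      singletFraction (idTensor Φ ρ) < singletFraction (idTensor Ψ ρ) := by
  cases isEmpty_or_nonempty S
  · exact absurd ⟨Φ, hΦ, LinearMap.ext fun X => Subsingleton.elim _ _⟩ h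
  let L : Matrix (S × S) (S × S) ℂ →ₗ[ℝ] Matrix (S × S) (S × S) ℂ :=
    { toFun := fun C => choi (ofChoi C ∘ₗ Φ)
      map_add' := fun C D => by
        ext x y
        simp [choi, ofChoi_apply, mul_add, Finset.sum_add_distrib]
      map_smul' := fun r C => by
        ext x y
        simp [choi, ofChoi_apply, Finset.mul_sum, mul_left_comm] }
  have hL : Continuous L := by
    refine continuous_matrix fun x y => ?_
    simp only [L, choi, ofChoi_apply, LinearMap.coe_mk, AddHom.coe_mk, of_apply,
      LinearMap.comp_apply]
    fun_prop
  have hmem : choi Ψ ∉ L '' choiSet S S := by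
    rintro ⟨C, hC, hCΨ⟩
    refine h ⟨ofChoi C, isChannel_ofChoi hC, ?_⟩
    rw [← ofChoi_choi Ψ, ← hCΨ]
    exact ofChoi_choi _
  have : LocallyConvexSpace ℝ (Matrix (S × S) (S × S) ℂ) :=
    inferInstanceAs (LocallyConvexSpace ℝ (S × S → S × S → ℂ))
  obtain ⟨f, u, hu, hf⟩ := RCLike.geometric_hahn_banach_closed_point (𝕜 := ℂ)
    (convex_choiSet.linear_image L) (isCompact_choiSet.image hL).isClosed hmem
  obtain ⟨ρ, r, c, hρ, hr, hpair⟩ := exists_isState_sfPairing_eq f.toLinearMap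
  refine ⟨ρ, hρ, ?_⟩
  obtain ⟨ε, hε, hval⟩ := (isGreatest_singletFraction (idTensor Φ ρ)).1
  -- The identity decoder already suffices after `Ψ`; after `Φ` an optimal `ε` must be beaten.
  have hle := (isGreatest_singletFraction (idTensor Ψ ρ)).2 ⟨_, isChannel_id, rfl⟩
  rw [← idTensor_comp, overlap_idTensor, hpair _ (choi_mem_choiSet (isChannel_id.comp hΨ))] at hle
  rw [← idTensor_comp, overlap_idTensor, hpair _ (choi_mem_choiSet (hε.comp hΦ))] at hval
  have hlt := hu _ ⟨choi ε, choi_mem_choiSet hε, congrArg (fun V => choi (V ∘ₗ Φ)) (ofChoi_choi ε)⟩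
  rw [hval]
  refine lt_of_lt_of_le ?_ hle
  have := mul_lt_mul_of_pos_left (hlt.trans hf) hr
  simpa using this

end Detection

end QInfo

end

theorem mainTheorem6 {A B B' S : Type*} [Fintype A] [DecidableEq A] [Fintype B] [DecidableEq B]
    [Fintype B'] [Fintype S] [DecidableEq S] :
    -- the maximum in the definition of the singlet fraction is attained
    (∀ ρ : Matrix (A × B) (A × B) ℂ, QInfo.IsState ρ →
      IsGreatest (QInfo.sfValues ρ) (QInfo.singletFraction ρ)) ∧
    -- no increase under operations on the second system
    (∀ (ρ : Matrix (A × B) (A × B) ℂ) (N : Matrix B B ℂ →ₗ[ℂ] Matrix B' B' ℂ),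
      QInfo.IsState ρ → QInfo.IsChannel N →
      QInfo.singletFraction (QInfo.idTensor N ρ) ≤ QInfo.singletFraction ρ) ∧
    -- relation to the guessing probability on classical-quantum states
    (∀ (p : A → ℝ) (ρ : A → Matrix B B ℂ), QInfo.IsEnsemble p ρ →
      IsGreatest (QInfo.guessValues p ρ) (QInfo.guessingProbability p ρ) ∧
      (Fintype.card A : ℝ) * QInfo.singletFraction (QInfo.cqState p ρ) =
        QInfo.guessingProbability p ρ) ∧
    -- detection of every dynamics that is not CP-divisible
    (∀ Λ : NNReal → Matrix S S ℂ →ₗ[ℂ] Matrix S S ℂ, (∀ t, QInfo.IsChannel (Λ t)) →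
      (QInfo.IsCPDivisible Λ → ∀ ρ : Matrix (A × S) (A × S) ℂ, QInfo.IsState ρ →
        Antitone fun t => QInfo.singletFraction (QInfo.idTensor (Λ t) ρ)) ∧
      (∀ t s : NNReal, t ≤ s → ¬ QInfo.HasCPIntermediate Λ s t →
        ∃ ρ : Matrix (S × S) (S × S) ℂ, QInfo.IsState ρ ∧
          QInfo.singletFraction (QInfo.idTensor (Λ t) ρ) <
            QInfo.singletFraction (QInfo.idTensor (Λ s) ρ)) ∧
      (¬ QInfo.IsCPDivisible Λ →
        ∃ (ρ : Matrix (S × S) (S × S) ℂ) (t s : NNReal), QInfo.IsState ρ ∧ t ≤ s ∧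
          QInfo.singletFraction (QInfo.idTensor (Λ t) ρ) <
            QInfo.singletFraction (QInfo.idTensor (Λ s) ρ))) := by
  refine ⟨fun ρ hρ => ?_, fun ρ N hρ hN => ?_, fun p ρ h => ?_, fun Λ hΛ => ⟨fun hdiv ρ hρ t s hts => ?_,
    fun t s _ h => QInfo.exists_singletFraction_lt (hΛ t) (hΛ s) h, fun h => ?_⟩⟩
  · have := QInfo.nonempty_of_isState hρ
    exact QInfo.isGreatest_singletFraction ρ
  · have := QInfo.nonempty_of_isState hρ
    exact QInfo.singletFraction_idTensor_le ρ hN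
  · have : Nonempty A := by
      by_contra hA
      rw [not_nonempty_iff] at hA
      simpa using h.2.1
    exact QInfo.isGreatest_guessingProbability p ρ
  · have := QInfo.nonempty_of_isState hρ
    obtain ⟨V, hV, hVs⟩ := hdiv t s hts
    dsimp only
    rw [hVs, QInfo.idTensor_comp]
    exact QInfo.singletFraction_idTensor_le _ hV
  · simp only [QInfo.IsCPDivisible, not_forall] at h
    obtain ⟨t, s, hts, h⟩ := h
    obtain ⟨ρ, hρ, hlt⟩ := QInfo.exists_singletFraction_lt (hΛ t) (hΛ s) h
    exact ⟨ρ, t, s, hρ, hts, hlt⟩
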